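/- Let $\mathcal E$ be a Grothendieck topos, with chosen finite products, terminal object $1$ and subobject classifier $\Omega$. A relation $R : A \nrightarrow B$ is a subobject of $A\times B$. Objects of $\mathcal E$ and relations, under relational composition, form the category $\mathrm{Rel}(\mathcal E)$, which is monoidal under $\times$ and $1$. A subobject of $A$ is identified with a relation $A \nrightarrow 1$. A promonoid is a monoid object in $\mathrm{Rel}(\mathcal E)$, and a homomorphism of promonoids is a homomorphism of monoid objects in $\mathrm{Rel}(\mathcal E)$. For an object $\Sigma$ (an alphabet) let $\Sigma^*$ be the free monoid object on $\Sigma$ in $\mathcal E$; regarding its structure morphisms as relations makes it a promonoid. A language over $\Sigma$ is a subobject of $\Sigma^*$. A non-deterministic automaton over $\Sigma$ consists of an object $S$ of states, subobjects $s_0 : I \rightarrowtail S$ and $s_f : F \rightarrowtail S$ of initial and final states, and a transition relation $\sigma : \Sigma\times S \nrightarrow S$. The transpose $\sigma^\dagger : \Sigma \to \Omega^{S\times S}$ extends uniquely to a homomorphism of monoids $\Sigma^* \to \Omega^{S\times S}$, where $\Omega^{S\times S}$ is the monoid of binary relations on $S$ under internal composition (the product of $R$ and $R'$ being "first $R$,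 then $R'$"); transposing back gives a relation $\overline\sigma : \Sigma^*\times S \nrightarrow S$. The language recognised by the automaton is the subobject of $\Sigma^*$ that corresponds to the composite relation $$\Sigma^* \cong \Sigma^*\times 1 \xrightarrow{\ \mathrm{id}\times s_0\ } \Sigma^*\times S \xrightarrow{\ \overline\sigma\ } S \xrightarrow{\ s_f\ } 1,$$ where $s_0$ is regarded as a relation $1\nrightarrow S$ and $s_f$ as a relation $S\nrightarrow 1$. A promonoid $M$ recognises a language $L\rightarrowtail\Sigma^*$ if there are a homomorphism of promonoids $h : \Sigma^* \nrightarrow M$ and a subobject $F$ of (the carrier of) $M$ such that $L$ corresponds to the composite relation $\Sigma^* \xrightarrow{\ h\ } M \xrightarrow{\ F\ } 1$. For a class $\mathcal K$ of objects of $\mathcal E$, a $\mathcal K$-automaton is a non-deterministic automaton whose object of states belongs to $\mathcal K$, and a $\mathcal K$-promonoid is a promonoid whose carrier belongs to $\mathcal K$. **Theorem.** Let $\mathcal K$ be a class of objects of $\mathcal E$ closed under binary products. Then for every object $\Sigma$ and every language $L$ over $\Sigma$: $L$ is recognised by some non-deterministic $\mathcal K$-automaton if and only if $L$ is recognised by some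 $\mathcal K$-promonoid. -/

import Mathlib

open CategoryTheory Limits MonoidalCategory CartesianMonoidalCategory Opposite
universe w u

namespace Promonoids

/-- `E` is a Grothendieck topos: it is equivalent to the category of sheaves of sets on a small
site. -/
class IsGrothendieckTopos (E : Type w) [Category.{u} E] : Prop where
  exists_site : ∃ (C : Type u) (_ : SmallCategory C) (J : GrothendieckTopology C),
    Nonempty (E ≌ Sheaf J (Type u))

section Sheaf

variable {C : Type u} [SmallCategory C] (J : GrothendieckTopology C)

theorem sheaf_hasColimits : HasColimits (Sheaf J (Type u)) :=
  ⟨fun _ _ => inferInstance⟩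

theorem sheaf_epi_of_isPullback {P X Y Z : Sheaf J (Type u)} {fst : P ⟶ X} {snd : P ⟶ Y}
    {f : X ⟶ Z} {g : Y ⟶ Z} (h : IsPullback fst snd f g) [hf : Epi f] : Epi snd := by
  rw [← Sheaf.isLocallySurjective_iff_epi'] at hf ⊢
  constructor
  intro U y
  refine J.superset_covering ?_ (hf.imageSieve_mem (g.hom.app (op U) y))
  rintro V i ⟨x, hx⟩
  have h2 := (h.map (sheafToPresheaf J (Type u))).map ((evaluation _ _).obj (op V))
  obtain ⟨p, hp1, hp2⟩ := Types.exists_of_isPullback h2 x (Y.obj.map i.op y) (by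
    have := NatTrans.naturality_apply g.hom i.op y
    exact hx.trans this.symm)
  exact ⟨p, hp2⟩

theorem sheaf_monoidalClosed : Nonempty (MonoidalClosed (Sheaf J (Type u))) := ⟨inferInstance⟩

/-- Free monoid objects exist in a topos of sheaves. -/
theorem sheaf_forget_isRightAdjoint : (Mon.forget (Sheaf J (Type u))).IsRightAdjoint := by
  have h1 : (Mon.forget (Cᵒᵖ ⥤ Type u)).IsRightAdjoint := by
    have : ((Functor.whiskeringRight Cᵒᵖ _ _).obj (forget MonCat.{u})).IsRightAdjoint :=
      ⟨_, ⟨MonCat.adj.whiskerRight Cᵒᵖ⟩⟩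
    let i : (Monoidal.monFunctorCategoryEquivalence Cᵒᵖ (Type u)).functor ⋙
        (Functor.whiskeringRight Cᵒᵖ _ _).obj monTypeEquivalenceMon.functor ⋙
        (Functor.whiskeringRight Cᵒᵖ _ _).obj (forget MonCat.{u}) ≅
        Mon.forget (Cᵒᵖ ⥤ Type u) := Iso.refl _
    exact Functor.isRightAdjoint_of_iso i
  obtain ⟨L, ⟨R, hR, adj⟩, hL⟩ : ∃ (L : (Cᵒᵖ ⥤ Type u) ⥤ Sheaf J (Type u))
      (_ : (R : Sheaf J (Type u) ⥤ (Cᵒᵖ ⥤ Type u)) ×' (_ : R.FullyFaithful) ×' (L ⊣ R)),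
      PreservesFiniteProducts L :=
    ⟨presheafToSheaf J (Type u), ⟨_, fullyFaithfulSheafToPresheaf J (Type u),
      sheafificationAdjunction J _⟩, inferInstance⟩
  let _ : L.Monoidal := .ofChosenFiniteProducts _
  let _ : R.LaxMonoidal := adj.rightAdjointLaxMonoidal
  have h2 : R.mapMon.IsRightAdjoint := ⟨_, ⟨adj.mapMon⟩⟩
  have adj2 := Adjunction.ofIsRightAdjoint (R.mapMon ⋙ Mon.forget (Cᵒᵖ ⥤ Type u))
  have adj3 := adj2.restrictFullyFaithful (iC := R) (iD := 𝟭 _)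
    hR (.id _)
    (L := R ⋙ (R.mapMon ⋙ Mon.forget (Cᵒᵖ ⥤ Type u)).leftAdjoint)
    (R := Mon.forget (Sheaf J (Type u))) (Iso.refl _) (Iso.refl _)
  exact ⟨_, ⟨adj3⟩⟩

end Sheaf

section Topos

variable (E : Type w) [Category.{u} E] [IsGrothendieckTopos E]

instance : HasFiniteLimits E := by
  obtain ⟨C, _, J, ⟨e⟩⟩ := IsGrothendieckTopos.exists_site (E := E)
  exact ⟨fun K _ _ => Adjunction.hasLimitsOfShape_of_equivalence e.functor⟩

instance : IsRegularEpiCategory E := by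
  obtain ⟨C, _, J, ⟨e⟩⟩ := IsGrothendieckTopos.exists_site (E := E)
  refine ⟨fun {X Y} f _ => ?_⟩
  have := IsRegularEpiCategory.regularEpiOfEpi (e.functor.map f)
  have := e.functor.effectiveEpi_of_map f inferInstance
  infer_instance

instance : Regular E := by
  obtain ⟨C, _, J, ⟨e⟩⟩ := IsGrothendieckTopos.exists_site (E := E)
  have := sheaf_hasColimits J
  have := Adjunction.hasColimitsOfShape_of_equivalence (J := WalkingParallelPair) e.functor
  refine ⟨fun _ => inferInstance, ⟨?_⟩⟩
  intro X Y Y' P f g f' g' h hg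
  rw [MorphismProperty.regularEpi_iff] at hg ⊢
  have : Epi g := (IsRegularEpi.getStruct g).epi
  have : Epi (e.functor.map g) := e.functor.map_epi g
  have := sheaf_epi_of_isPullback J (h.map e.functor)
  have : Epi g' := e.functor.epi_of_epi_map this
  exact IsRegularEpiCategory.regularEpiOfEpi g'

instance : HasSubobjectClassifier E := by
  obtain ⟨C, _, J, ⟨e⟩⟩ := IsGrothendieckTopos.exists_site (E := E)
  obtain ⟨c⟩ := HasSubobjectClassifier.exists_classifier (C := Sheaf J (Type u))
  exact ⟨⟨c.ofEquivalence e.symm⟩⟩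

theorem monoidalClosed_of_topos [CartesianMonoidalCategory E] : Nonempty (MonoidalClosed E) := by
  obtain ⟨C, _, J, ⟨e⟩⟩ := IsGrothendieckTopos.exists_site (E := E)
  obtain ⟨this⟩ := sheaf_monoidalClosed J
  exact ⟨@cartesianClosedOfEquiv _ _ _ _ _ _ e.symm this⟩

instance forget_isRightAdjoint [CartesianMonoidalCategory E] : (Mon.forget E).IsRightAdjoint := by
  obtain ⟨C, _, J, ⟨e⟩⟩ := IsGrothendieckTopos.exists_site (E := E)
  have := sheaf_forget_isRightAdjoint J
  let _ : e.functor.Monoidal := .ofChosenFiniteProducts _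
  have : e.functor.mapMon.EssSurj := ⟨fun M => by
    rw [Functor.essImage_mapMon]
    exact Functor.EssSurj.mem_essImage (F := e.functor) M.X⟩
  have : e.functor.mapMon.IsEquivalence := {}
  let i : e.functor.mapMon ⋙ Mon.forget _ ⋙ e.inverse ≅ Mon.forget E :=
    Functor.isoWhiskerLeft (Mon.forget E) e.unitIso.symm
  exact Functor.isRightAdjoint_of_iso i

end Topos

section Factors

variable {E : Type w} [Category.{u} E]

theorem subobject_ext {A : E} {P Q : Subobject A}
    (h : ∀ (X : E) (z : X ⟶ A), P.Factors z ↔ Q.Factors z) : P = Q :=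
  le_antisymm (Subobject.le_of_factors ((h _ _).1 (Subobject.factors_self P)))
    (Subobject.le_of_factors ((h _ _).2 (Subobject.factors_self Q)))

theorem factors_of_comp_eq {A X : E} {P : Subobject A} (t : X ⟶ (P : E)) {z : X ⟶ A}
    (h : t ≫ P.arrow = z) : P.Factors z :=
  h ▸ Subobject.factors_comp_arrow t

theorem factors_of_cover {A X Y : E} (P : Subobject A) (e : Y ⟶ X) [IsRegularEpi e] (z : X ⟶ A)
    (h : P.Factors (e ≫ z)) : P.Factors z := by
  have sq : CommSq (P.factorThru _ h) e P.arrow z := ⟨by simp⟩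
  have : StrongEpi e := inferInstance
  have : sq.HasLift := inferInstance
  exact factors_of_comp_eq _ sq.fac_right

variable [Regular E]

theorem factors_pullback_iff {A B X : E} (f : A ⟶ B) (P : Subobject B) (z : X ⟶ A) :
    ((Subobject.pullback f).obj P).Factors z ↔ P.Factors (z ≫ f) := by
  have sq := Subobject.isPullback f P
  constructor
  · intro h
    refine factors_of_comp_eq (Subobject.factorThru _ z h ≫ Subobject.pullbackπ f P) ?_
    rw [Category.assoc, sq.w, Subobject.factorThru_arrow_assoc]
  · intro h
    exact factors_of_comp_eq (sq.lift (P.factorThru _ h) z (by simp)) (by simp)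

theorem exists_cover {A B : E} (f : A ⟶ B) (Q : Subobject A) :
    ∃ e : (Q : E) ⟶ ((Subobject.exists f).obj Q : E), IsRegularEpi e ∧
      e ≫ ((Subobject.exists f).obj Q).arrow = Q.arrow ≫ f := by
  have := strongEpi_of_strongEpiMonoFactorisation
    (Regular.strongEpiMonoFactorisation (Q.arrow ≫ f)) (Subobject.imageFactorisation f Q).isImage
  have h : IsRegularEpi (Subobject.imageFactorisation f Q).F.e := inferInstance
  refine ⟨(Subobject.imageFactorisation f Q).F.e, h, ?_⟩
  have := (Subobject.imageFactorisation f Q).F.fac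
  rwa [Subobject.imageFactorisation_F_m] at this

theorem factors_exists_iff {A B X : E} (f : A ⟶ B) (Q : Subobject A) (z : X ⟶ B) :
    ((Subobject.exists f).obj Q).Factors z ↔
      ∃ (Y : E) (e : Y ⟶ X) (w : Y ⟶ A), IsRegularEpi e ∧ Q.Factors w ∧ w ≫ f = e ≫ z := by
  obtain ⟨c, hc, hcf⟩ := exists_cover f Q
  constructor
  · intro h
    refine ⟨pullback c (Subobject.factorThru _ z h), pullback.snd _ _, pullback.fst _ _ ≫ Q.arrow,
      inferInstance, Subobject.factors_comp_arrow _, ?_⟩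
    rw [Category.assoc, ← hcf, pullback.condition_assoc, Subobject.factorThru_arrow]
  · rintro ⟨Y, e, w, he, hw, hz⟩
    refine factors_of_cover _ e z ?_
    rw [← hz]
    refine factors_of_comp_eq (Q.factorThru w hw ≫ c) ?_
    rw [Category.assoc, hcf, Subobject.factorThru_arrow_assoc]

theorem cover_comp {X Y Z : E} (f : X ⟶ Y) (g : Y ⟶ Z) [IsRegularEpi f] [IsRegularEpi g] :
    IsRegularEpi (f ≫ g) := by
  have := strongEpi_comp f g
  infer_instance

end Factors

variable (E : Type w) [Category.{u} E]

/-- The objects of the category of relations of `E`: those of `E`. -/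
structure Rel where
  of ::
  obj : E

namespace Rel

variable {E} [CartesianMonoidalCategory E]

/-- A relation from `A` to `B` is a subobject of the product of `A` and `B`. -/
@[ext]
structure Hom (A B : Rel E) where
  rel : Subobject (A.obj ⊗ B.obj)

/-- The generalised element `(a, b)` belongs to the relation `R`. -/
def Hom.Mem {A B : Rel E} (R : Hom A B) {X : E} (a : X ⟶ A.obj) (b : X ⟶ B.obj) : Prop :=
  R.rel.Factors (lift a b)

instance (A B : E) (f : A ⟶ B) : Mono (lift (𝟙 A) f) :=
  mono_of_mono_fac (lift_fst (𝟙 A) f)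

/-- The graph of a morphism, as a relation. -/
noncomputable def graphHom {A B : E} (f : A ⟶ B) : Hom (of A) (of B) :=
  ⟨Subobject.mk (lift (𝟙 A) f)⟩

theorem Hom.ext_mem {A B : Rel E} {R S : Hom A B}
    (h : ∀ (X : E) (a : X ⟶ A.obj) (b : X ⟶ B.obj), R.Mem a b ↔ S.Mem a b) : R = S := by
  refine Hom.ext (subobject_ext fun X z => ?_)
  have := h X (z ≫ fst _ _) (z ≫ snd _ _)
  have hz : lift (z ≫ fst A.obj B.obj) (z ≫ snd _ _) = z := by ext <;> simp
  rwa [Hom.Mem, Hom.Mem, hz] at this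

theorem Hom.Mem.comp {A B : Rel E} {R : Hom A B} {X Y : E} {a : X ⟶ A.obj} {b : X ⟶ B.obj}
    (h : R.Mem a b) (f : Y ⟶ X) : R.Mem (f ≫ a) (f ≫ b) := by
  rw [Hom.Mem, ← comp_lift]
  exact Subobject.factors_of_factors_right f h

theorem Hom.mem_of_cover {A B : Rel E} {R : Hom A B} {X Y : E} {a : X ⟶ A.obj} {b : X ⟶ B.obj}
    (e : Y ⟶ X) [IsRegularEpi e] (h : R.Mem (e ≫ a) (e ≫ b)) : R.Mem a b := by
  rw [Hom.Mem, ← comp_lift] at h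
  exact factors_of_cover _ e _ h

theorem mem_graphHom {A B X : E} (f : A ⟶ B) (a : X ⟶ A) (b : X ⟶ B) :
    (graphHom f).Mem a b ↔ a ≫ f = b := by
  unfold Hom.Mem graphHom
  constructor
  · intro h
    obtain ⟨t, ht⟩ : ∃ t : X ⟶ A, t ≫ lift (𝟙 A) f = lift a b :=
      (Subobject.mk_factors_iff (lift (𝟙 A) f) (lift a b)).1 h
    rw [comp_lift, Category.comp_id] at ht
    have h1 := congrArg (· ≫ fst _ _) ht
    have h2 := congrArg (· ≫ snd _ _) ht
    simp only [lift_fst, lift_snd] at h1 h2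
    rw [← h1, h2]
  · rintro rfl
    refine (Subobject.mk_factors_iff (lift (𝟙 A) f) _).2 ⟨a, ?_⟩
    simp

variable [Regular E]

/-- Composition of relations, in diagrammatic order: the image in `A × C` of the object of all
triples `(a, b, c)` with `(a, b)` in `R` and `(b, c)` in `S`. -/
noncomputable def Hom.comp {A B C : Rel E} (R : Hom A B) (S : Hom B C) : Hom A C :=
  ⟨(Subobject.exists (A.obj ◁ snd B.obj C.obj)).obj
    ((Subobject.pullback (A.obj ◁ fst B.obj C.obj)).obj R.rel ⊓
      (Subobject.pullback (snd A.obj (B.obj ⊗ C.obj))).obj S.rel)⟩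

/-- The product of two relations. -/
noncomputable def Hom.prod {A B A' B' : Rel E} (R : Hom A B) (S : Hom A' B') :
    Hom (of (A.obj ⊗ A'.obj)) (of (B.obj ⊗ B'.obj)) :=
  ⟨(Subobject.pullback (fst A.obj A'.obj ⊗ₘ fst B.obj B'.obj)).obj R.rel ⊓
    (Subobject.pullback (snd A.obj A'.obj ⊗ₘ snd B.obj B'.obj)).obj S.rel⟩

theorem Hom.mem_comp {A B C : Rel E} (R : Hom A B) (S : Hom B C) {X : E} (a : X ⟶ A.obj)
    (c : X ⟶ C.obj) : (R.comp S).Mem a c ↔ ∃ (Y : E) (e : Y ⟶ X) (b : Y ⟶ B.obj),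
      IsRegularEpi e ∧ R.Mem (e ≫ a) b ∧ S.Mem b (e ≫ c) := by
  unfold Hom.Mem Hom.comp
  rw [factors_exists_iff]
  constructor
  · rintro ⟨Y, e, w, he, hw, hz⟩
    rw [Subobject.inf_factors, factors_pullback_iff, factors_pullback_iff] at hw
    have h1 := congrArg (· ≫ fst _ _) hz
    have h2 := congrArg (· ≫ snd _ _) hz
    simp at h1 h2
    refine ⟨Y, e, w ≫ snd _ _ ≫ fst _ _, he, ?_, ?_⟩
    · convert hw.1 using 1
      ext <;> simp [h1]
    · convert hw.2 using 1
      ext <;> simp [h2]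
  · rintro ⟨Y, e, b, he, hR, hS⟩
    refine ⟨Y, e, lift (e ≫ a) (lift b (e ≫ c)), he, ?_, ?_⟩
    · rw [Subobject.inf_factors, factors_pullback_iff, factors_pullback_iff]
      constructor
      · convert hR using 1
        simp
      · convert hS using 1
        simp
    · ext <;> simp

theorem Hom.mem_prod {A B A' B' : Rel E} (R : Hom A B) (S : Hom A' B') {X : E}
    (a : X ⟶ A.obj ⊗ A'.obj) (b : X ⟶ B.obj ⊗ B'.obj) :
    (R.prod S).Mem a b ↔ R.Mem (a ≫ fst _ _) (b ≫ fst _ _) ∧ S.Mem (a ≫ snd _ _) (b ≫ snd _ _) := by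
  unfold Hom.Mem Hom.prod
  rw [Subobject.inf_factors, factors_pullback_iff, factors_pullback_iff]
  simp

instance : Quiver (Rel E) where
  Hom := Hom

/-- The category of relations of `E`. -/
noncomputable instance : Category (Rel E) where
  id A := graphHom (𝟙 A.obj)
  comp := Hom.comp
  id_comp {A B} R := Hom.ext_mem fun X a b => by
    rw [Hom.mem_comp]
    constructor
    · rintro ⟨Y, e, a', he, h1, h2⟩
      rw [mem_graphHom] at h1
      simp only [Category.comp_id] at h1
      subst h1
      exact Hom.mem_of_cover e h2
    · intro h
      refine ⟨X, 𝟙 X, a, inferInstance, ?_, by simpa using h⟩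
      rw [mem_graphHom]; simp
  comp_id {A B} R := Hom.ext_mem fun X a b => by
    rw [Hom.mem_comp]
    constructor
    · rintro ⟨Y, e, a', he, h1, h2⟩
      rw [mem_graphHom] at h2
      simp only [Category.comp_id] at h2
      subst h2
      exact Hom.mem_of_cover e h1
    · intro h
      refine ⟨X, 𝟙 X, b, inferInstance, by simpa using h, ?_⟩
      rw [mem_graphHom]; simp
  assoc {A B C D} R S T := Hom.ext_mem fun X a d => by
    simp only [Hom.mem_comp]
    constructor
    · rintro ⟨Y, e, c, he, ⟨Z, e', b, he', h1, h2⟩, h3⟩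
      refine ⟨Z, e' ≫ e, b, cover_comp _ _, by simpa using h1,
        Z, 𝟙 _, e' ≫ c, inferInstance, by simpa using h2, ?_⟩
      simpa using h3.comp e'
    · rintro ⟨Y, e, b, he, h1, Z, e', c, he', h2, h3⟩
      refine ⟨Z, e' ≫ e, c, cover_comp _ _, ⟨Z, 𝟙 _, e' ≫ b, inferInstance, ?_, by simpa using h2⟩,
        by simpa using h3⟩
      simpa using h1.comp e'

theorem graphHom_comp {A B C : E} (f : A ⟶ B) (g : B ⟶ C) :
    graphHom (f ≫ g) = (graphHom f).comp (graphHom g) := by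
  refine Hom.ext_mem fun X a c => ?_
  simp only [Hom.mem_comp, mem_graphHom]
  constructor
  · rintro rfl
    exact ⟨X, 𝟙 X, a ≫ f, inferInstance, by simp⟩
  · rintro ⟨Y, e, b, he, h1, h2⟩
    have : Epi e := (IsRegularEpi.getStruct e).epi
    rw [← cancel_epi e, ← h2, ← h1]
    simp

/-- A morphism, seen as a functional relation. -/
noncomputable def graph : E ⥤ Rel E where
  obj A := of A
  map f := graphHom f
  map_comp f g := graphHom_comp f g

theorem mem_graphHom_comp {A B : E} {C : Rel E} (f : A ⟶ B) (S : Hom (of B) C) {X : E}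
    (a : X ⟶ A) (c : X ⟶ C.obj) : ((graphHom f).comp S).Mem a c ↔ S.Mem (a ≫ f) c := by
  simp only [Hom.mem_comp, mem_graphHom]
  constructor
  · rintro ⟨Y, e, b, he, rfl, h2⟩
    rw [Category.assoc] at h2
    exact Hom.mem_of_cover e h2
  · intro h
    exact ⟨X, 𝟙 X, a ≫ f, inferInstance, by simp, by simpa using h⟩

theorem mem_comp_graphHom {A : Rel E} {B C : E} (R : Hom A (of B)) (f : B ⟶ C) [IsIso f] {X : E}
    (a : X ⟶ A.obj) (c : X ⟶ C) : (R.comp (graphHom f)).Mem a c ↔ R.Mem a (c ≫ inv f) := by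
  simp only [Hom.mem_comp, mem_graphHom]
  constructor
  · rintro ⟨Y, e, b, he, h1, h2⟩
    refine Hom.mem_of_cover e ?_
    rw [← Category.assoc, ← h2]
    simpa using h1
  · intro h
    exact ⟨X, 𝟙 X, c ≫ inv f, inferInstance, by simpa using h, by simp⟩

theorem graphHom_prod {A B A' B' : E} (f : A ⟶ B) (g : A' ⟶ B') :
    (graphHom f).prod (graphHom g) = graphHom (f ⊗ₘ g) := by
  refine Hom.ext_mem fun X a b => ?_
  simp only [Hom.mem_prod, mem_graphHom]
  constructor
  · rintro ⟨h1, h2⟩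
    ext
    · simpa using h1
    · simpa using h2
  · rintro rfl
    simp

theorem Hom.prod_comp {A B C A' B' C' : Rel E} (R : Hom A B) (R' : Hom A' B') (S : Hom B C)
    (S' : Hom B' C') : (R.prod R').comp (S.prod S') = (R.comp S).prod (R'.comp S') := by
  refine Hom.ext_mem fun X a c => ?_
  simp only [Hom.mem_comp, Hom.mem_prod]
  constructor
  · rintro ⟨Y, e, b, he, h1, h2⟩
    exact ⟨⟨Y, e, b ≫ fst _ _, he, by simpa using h1.1, by simpa using h2.1⟩,
      ⟨Y, e, b ≫ snd _ _, he, by simpa using h1.2, by simpa using h2.2⟩⟩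
  · rintro ⟨⟨Y, e, b, he, h1, h2⟩, ⟨Y', e', b', he', h1', h2'⟩⟩
    refine ⟨pullback e e', pullback.fst e e' ≫ e,
      lift (pullback.fst e e' ≫ b) (pullback.snd e e' ≫ b'), cover_comp _ _, ⟨?_, ?_⟩, ⟨?_, ?_⟩⟩
    · simpa using h1.comp (pullback.fst e e')
    · simpa [pullback.condition_assoc] using h1'.comp (pullback.snd e e')
    · simpa using h2.comp (pullback.fst e e')
    · simpa [pullback.condition_assoc] using h2'.comp (pullback.snd e e')

theorem Hom.prod_assoc {A₁ A₂ A₃ B₁ B₂ B₃ : Rel E} (R₁ : Hom A₁ B₁) (R₂ : Hom A₂ B₂)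
    (R₃ : Hom A₃ B₃) :
    ((R₁.prod R₂).prod R₃).comp (graphHom (α_ B₁.obj B₂.obj B₃.obj).hom) =
      (graphHom (α_ A₁.obj A₂.obj A₃.obj).hom).comp (R₁.prod (R₂.prod R₃)) := by
  refine Hom.ext_mem fun X a b => ?_
  rw [mem_comp_graphHom, mem_graphHom_comp]
  simp [Hom.mem_prod, and_assoc]

theorem Hom.prod_left_unit {A B : Rel E} (R : Hom A B) :
    ((graphHom (𝟙 (𝟙_ E))).prod R).comp (graphHom (λ_ B.obj).hom) =
      (graphHom (λ_ A.obj).hom).comp R := by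
  refine Hom.ext_mem fun X a b => ?_
  rw [mem_comp_graphHom, mem_graphHom_comp]
  simp [Hom.mem_prod, mem_graphHom, leftUnitor_hom]
  exact fun _ => toUnit_unique _ _

theorem Hom.prod_right_unit {A B : Rel E} (R : Hom A B) :
    (R.prod (graphHom (𝟙 (𝟙_ E)))).comp (graphHom (ρ_ B.obj).hom) =
      (graphHom (ρ_ A.obj).hom).comp R := by
  refine Hom.ext_mem fun X a b => ?_
  rw [mem_comp_graphHom, mem_graphHom_comp]
  simp [Hom.mem_prod, mem_graphHom, rightUnitor_hom]
  exact fun _ => toUnit_unique _ _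

noncomputable instance : MonoidalCategoryStruct (Rel E) where
  tensorObj A B := of (A.obj ⊗ B.obj)
  tensorUnit := of (𝟙_ E)
  tensorHom R S := Hom.prod R S
  whiskerLeft A _ _ R := Hom.prod (graphHom (𝟙 A.obj)) R
  whiskerRight R A := Hom.prod R (graphHom (𝟙 A.obj))
  associator A B C := graph.mapIso (α_ A.obj B.obj C.obj)
  leftUnitor A := graph.mapIso (λ_ A.obj)
  rightUnitor A := graph.mapIso (ρ_ A.obj)

/-- The category of relations is monoidal under the product of `E`. -/
noncomputable instance : MonoidalCategory (Rel E) :=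
  MonoidalCategory.ofTensorHom
    (id_tensorHom_id := fun A B =>
      (graphHom_prod (𝟙 A.obj) (𝟙 B.obj)).trans (congrArg graphHom (id_tensorHom_id A.obj B.obj)))
    (id_tensorHom := fun _ _ _ _ => rfl)
    (tensorHom_id := fun _ _ => rfl)
    (tensorHom_comp_tensorHom := fun R R' S S' => Hom.prod_comp R R' S S')
    (associator_naturality := fun R₁ R₂ R₃ => Hom.prod_assoc R₁ R₂ R₃)
    (leftUnitor_naturality := fun R => Hom.prod_left_unit R)
    (rightUnitor_naturality := fun R => Hom.prod_right_unit R)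
    (pentagon := fun A B C D => by
      change ((graphHom (α_ A.obj B.obj C.obj).hom).prod (graphHom (𝟙 D.obj))).comp
        ((graphHom (α_ A.obj (B.obj ⊗ C.obj) D.obj).hom).comp
          ((graphHom (𝟙 A.obj)).prod (graphHom (α_ B.obj C.obj D.obj).hom))) =
        (graphHom (α_ (A.obj ⊗ B.obj) C.obj D.obj).hom).comp
          (graphHom (α_ A.obj B.obj (C.obj ⊗ D.obj)).hom)
      rw [graphHom_prod, graphHom_prod, ← graphHom_comp, ← graphHom_comp, ← graphHom_comp]
      simp)
    (triangle := fun A B => by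
      change (graphHom (α_ A.obj (𝟙_ E) B.obj).hom).comp
        ((graphHom (𝟙 A.obj)).prod (graphHom (λ_ B.obj).hom)) =
          (graphHom (ρ_ A.obj).hom).prod (graphHom (𝟙 B.obj))
      rw [graphHom_prod, graphHom_prod, ← graphHom_comp]
      simp)

/-- Morphisms, seen as relations, compose and multiply as in `E`. -/
noncomputable instance : (graph (E := E)).Monoidal :=
  Functor.CoreMonoidal.toMonoidal
    { εIso := Iso.refl _
      μIso A B := Iso.refl _
      μIso_hom_natural_left {A B} f C := by
        change ((graphHom f).prod (graphHom (𝟙 C))).comp (graphHom (𝟙 (B ⊗ C))) =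
          (graphHom (𝟙 (A ⊗ C))).comp (graphHom (f ▷ C))
        rw [graphHom_prod, ← graphHom_comp, ← graphHom_comp]
        simp
      μIso_hom_natural_right {A B} C f := by
        change ((graphHom (𝟙 C)).prod (graphHom f)).comp (graphHom (𝟙 (C ⊗ B))) =
          (graphHom (𝟙 (C ⊗ A))).comp (graphHom (C ◁ f))
        rw [graphHom_prod, ← graphHom_comp, ← graphHom_comp]
        simp
      associativity A B C := by
        change ((graphHom (𝟙 (A ⊗ B))).prod (graphHom (𝟙 C))).comp
            ((graphHom (𝟙 ((A ⊗ B) ⊗ C))).comp (graphHom (α_ A B C).hom)) =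
          (graphHom (α_ A B C).hom).comp (((graphHom (𝟙 A)).prod (graphHom (𝟙 (B ⊗ C)))).comp
            (graphHom (𝟙 (A ⊗ (B ⊗ C)))))
        rw [graphHom_prod, graphHom_prod]
        simp only [← graphHom_comp]
        simp
      left_unitality A := by
        change graphHom (λ_ A).hom = ((graphHom (𝟙 (𝟙_ E))).prod (graphHom (𝟙 A))).comp
          ((graphHom (𝟙 (𝟙_ E ⊗ A))).comp (graphHom (λ_ A).hom))
        rw [graphHom_prod]
        simp only [← graphHom_comp]
        simp
      right_unitality A := by
        change graphHom (ρ_ A).hom = ((graphHom (𝟙 A)).prod (graphHom (𝟙 (𝟙_ E)))).comp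
          ((graphHom (𝟙 (A ⊗ 𝟙_ E))).comp (graphHom (ρ_ A).hom))
        rw [graphHom_prod]
        simp only [← graphHom_comp]
        simp }

/-- A subobject `P` of `A`, as a relation from `A` to the terminal object. -/
noncomputable def ofSubobject {A : E} (P : Subobject A) : of A ⟶ 𝟙_ (Rel E) :=
  ⟨(Subobject.pullback (fst A (𝟙_ E))).obj P⟩

/-- A subobject `P` of `A`, as a relation from the terminal object to `A`. -/
noncomputable def coSubobject {A : E} (P : Subobject A) : 𝟙_ (Rel E) ⟶ of A :=
  ⟨(Subobject.pullback (snd (𝟙_ E) A)).obj P⟩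

/-- The subobject of `A` that corresponds to a relation from `A` to the terminal object. -/
noncomputable def toSubobject {A : E} (R : of A ⟶ 𝟙_ (Rel E)) : Subobject A :=
  (Subobject.pullback (ρ_ A).inv).obj (Hom.rel R)

end Rel

section RelationObject

variable {E} [CartesianMonoidalCategory E]

/-- An `X`-indexed family of binary relations on `S`: a relation from `X × S` to `S`. -/
def Family (X S : E) : Type max w u := Rel.Hom (.of (X ⊗ S)) (.of S)

namespace Family

/-- The unit family: at each index, the identity relation on `S`. -/
noncomputable instance (X S : E) : One (Family X S) := ⟨Rel.graphHom (snd X S)⟩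

theorem mem_one {X S Y : E} (z : Y ⟶ X ⊗ S) (s : Y ⟶ S) :
    Rel.Hom.Mem (1 : Family X S) z s ↔ z ≫ snd X S = s :=
  Rel.mem_graphHom _ _ _

theorem ext_mem {X S : E} {R T : Family X S}
    (h : ∀ (Y : E) (z : Y ⟶ X ⊗ S) (s : Y ⟶ S), Rel.Hom.Mem R z s ↔ Rel.Hom.Mem T z s) :
    R = T :=
  Rel.Hom.ext_mem h

variable [Regular E]

/-- The index-wise composition of two families, in diagrammatic order: the relation
`X × S → X × (X × S) → X × S → S`. -/
noncomputable instance (X S : E) : Mul (Family X S) :=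
  ⟨fun R T => (Rel.graphHom (lift (fst X S) (𝟙 (X ⊗ S)))).comp
    (((Rel.graphHom (𝟙 X)).prod R).comp T)⟩

theorem mem_mul {X S Y : E} (R T : Family X S) (z : Y ⟶ X ⊗ S) (s : Y ⟶ S) :
    Rel.Hom.Mem (R * T) z s ↔ ∃ (Z : E) (e : Z ⟶ Y) (t : Z ⟶ S), IsRegularEpi e ∧
      Rel.Hom.Mem R (e ≫ z) t ∧ Rel.Hom.Mem T (lift (e ≫ z ≫ fst X S) t) (e ≫ s) := by
  refine (Rel.mem_graphHom_comp _ _ _ _).trans ((Rel.Hom.mem_comp _ _ _ _).trans ?_)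
  constructor
  · rintro ⟨Z, e, b, he, h12, h3⟩
    obtain ⟨h1, h2⟩ := (Rel.Hom.mem_prod _ _ _ _).1 h12
    replace h1 := (Rel.mem_graphHom _ _ _).1 h1
    simp only [comp_lift, lift_fst, lift_snd, Category.comp_id] at h1 h2
    refine ⟨Z, e, b ≫ snd X S, he, h2, ?_⟩
    convert h3 using 1
    ext
    · simpa using h1
    · simp
  · rintro ⟨Z, e, t, he, h1, h2⟩
    refine ⟨Z, e, lift (e ≫ z ≫ fst X S) t, he,
      (Rel.Hom.mem_prod _ _ _ _).2 ⟨(Rel.mem_graphHom _ _ _).2 (by simp), ?_⟩, h2⟩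
    simpa using h1

/-- Families of relations form a monoid under index-wise composition. -/
noncomputable instance (X S : E) : Monoid (Family X S) where
  mul_assoc R T U := by
    refine ext_mem fun Y z s => ?_
    simp only [mem_mul]
    constructor
    · rintro ⟨Z, e, t, he, ⟨Z', e', t', he', h1, h2⟩, h3⟩
      refine ⟨Z', e' ≫ e, t', cover_comp _ _, by simpa using h1,
        Z', 𝟙 _, e' ≫ t, inferInstance, by simpa using h2, ?_⟩
      simpa using h3.comp e'
    · rintro ⟨Z, e, t, he, h1, Z', e', t', he', h2, h3⟩
      refine ⟨Z', e' ≫ e, t', cover_comp _ _,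
        ⟨Z', 𝟙 _, e' ≫ t, inferInstance, by simpa using h1.comp e', by simpa using h2⟩,
        by simpa using h3⟩
  one_mul R := by
    refine ext_mem fun Y z s => ?_
    simp only [mem_mul, mem_one]
    constructor
    · rintro ⟨Z, e, t, he, rfl, h⟩
      refine Rel.Hom.mem_of_cover e ?_
      convert h using 1
      ext <;> simp
    · intro h
      refine ⟨Y, 𝟙 Y, z ≫ snd _ _, inferInstance, by simp, ?_⟩
      convert h using 1
      · ext <;> simp
      · simp
  mul_one R := by
    refine ext_mem fun Y z s => ?_
    simp only [mem_mul, mem_one]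
    constructor
    · rintro ⟨Z, e, t, he, h, h'⟩
      refine Rel.Hom.mem_of_cover e ?_
      simp only [lift_snd] at h'
      rwa [← h']
    · intro h
      exact ⟨Y, 𝟙 Y, s, inferInstance, by simpa using h, by simp⟩

/-- The reindexing of a family along a morphism. -/
noncomputable def reindex {X X' : E} (S : E) (f : X' ⟶ X) (R : Family X S) : Family X' S :=
  ⟨(Subobject.pullback (f ▷ S ▷ S)).obj (Rel.Hom.rel R)⟩

theorem mem_reindex {X X' S Y : E} (f : X' ⟶ X) (R : Family X S) (z : Y ⟶ X' ⊗ S) (s : Y ⟶ S) :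
    Rel.Hom.Mem (reindex S f R) z s ↔ Rel.Hom.Mem R (z ≫ f ▷ S) s := by
  refine (factors_pullback_iff _ _ _).trans ?_
  simp [Rel.Hom.Mem]

/-- The presheaf of monoids of families of binary relations on `S`. -/
noncomputable def presheaf (S : E) : Eᵒᵖ ⥤ MonCat.{max w u} where
  obj X := MonCat.of (Family X.unop S)
  map f := MonCat.ofHom
    { toFun := reindex S f.unop
      map_one' := by
        refine ext_mem fun Y z s => ?_
        simp [mem_reindex, mem_one]
      map_mul' R T := by
        refine ext_mem fun Y z s => ?_
        simp only [mem_reindex, mem_mul]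
        simp }
  map_id X := by
    ext R
    refine ext_mem fun Y z s => ?_
    refine (mem_reindex _ _ _ _).trans ?_
    simp
  map_comp f g := by
    ext R
    refine ext_mem fun Y z s => ?_
    refine (mem_reindex _ _ _ _).trans (Iff.trans ?_ (mem_reindex _ _ _ _).symm)
    refine Iff.trans ?_ (mem_reindex _ _ _ _).symm
    simp

end Family

end RelationObject

section Automata

variable {E} [CartesianMonoidalCategory E] [IsGrothendieckTopos E]

instance (S : E) : (Family.presheaf S ⋙ forget MonCat).IsRepresentable := by
  obtain ⟨_⟩ := monoidalClosed_of_topos E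
  have c := (HasSubobjectClassifier.exists_classifier (C := E)).some.representableBy
  let _ : BraidedCategory E := .ofCartesianMonoidalCategory
  have : (tensorRight S).IsLeftAdjoint :=
    Functor.isLeftAdjoint_of_iso (BraidedCategory.tensorLeftIsoTensorRight S)
  have adj := Adjunction.ofIsLeftAdjoint (tensorRight S ⋙ tensorRight S)
  refine Functor.RepresentableBy.isRepresentable
    (Y := (tensorRight S ⋙ tensorRight S).rightAdjoint.obj _)
    { homEquiv := fun {X} => (adj.homEquiv X _).symm.trans
        (c.homEquiv.trans ⟨fun P => ⟨P⟩, fun R => Rel.Hom.rel R, fun _ => rfl, fun _ => rfl⟩)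
      homEquiv_comp := ?_ }
  intro X X' f g
  refine Rel.Hom.ext ?_
  change c.homEquiv _ = (Subobject.pullback (f ▷ S ▷ S)).obj (c.homEquiv _)
  rw [Adjunction.homEquiv_naturality_left_symm, c.homEquiv_comp]
  rfl

/-- The object `Ω^(S × S)` of binary relations on `S`: morphisms from `X` to it correspond to
`X`-indexed families of binary relations on `S`. -/
noncomputable def relObj (S : E) : E := (Family.presheaf S ⋙ forget MonCat).reprX

/-- The universal property of `relObj S`. -/
noncomputable def relObjRepr (S : E) :
    (Family.presheaf S ⋙ forget MonCat).RepresentableBy (relObj S) :=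
  (Family.presheaf S ⋙ forget MonCat).representableBy

/-- The monoid structure on `Ω^(S × S)` given by internal composition of relations. -/
noncomputable instance (S : E) : MonObj (relObj S) :=
  MonObj.ofRepresentableBy (relObj S) (Family.presheaf S) (relObjRepr S)

/-- Transposition between relations from `X × S` to `S` and morphisms from `X` to `Ω^(S × S)`. -/
noncomputable def transpose (X S : E) :
    (X ⟶ relObj S) ≃ Family X S :=
  (relObjRepr S).homEquiv

/-- The object of words over the alphabet `A`, with concatenation: the free monoid object on `A`. -/
noncomputable def words (A : E) : Mon E := (Mon.forget E).leftAdjoint.obj A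

/-- The extension of a morphism from the alphabet to a monoid to a homomorphism from the words. -/
noncomputable def wordsExtend {A : E} {M : Mon E} (f : A ⟶ M.X) : words A ⟶ M :=
  ((Adjunction.ofIsRightAdjoint (Mon.forget E)).homEquiv A M).symm f

/-- Languages over the alphabet `A`. -/
abbrev Lang (A : E) := Subobject (words A).X

/-- A non-deterministic automaton over the alphabet `A`. -/
structure Automaton (A : E) where
  state : E
  init : Subobject state
  final : Subobject state
  trans : (Rel.of (A ⊗ state) : Rel E) ⟶ Rel.of state

/-- The extended transition relation of an automaton, from `A* × S` to `S`: the transpose of the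
homomorphism of monoids from `A*` to `Ω^(S × S)` that extends the transpose of the transition
relation. -/
noncomputable def Automaton.run {A : E} (T : Automaton A) :
    (Rel.of ((words A).X ⊗ T.state) : Rel E) ⟶ Rel.of T.state :=
  transpose _ _ (wordsExtend (M := Mon.mk (relObj T.state)) ((transpose _ _).symm T.trans)).hom

/-- The language recognised by an automaton: the subobject of `A*` given by the relation
`A* → A* × S → S → 1`. -/
noncomputable def Automaton.language {A : E} (T : Automaton A) : Lang A :=
  Rel.toSubobject ((ρ_ (Rel.of (words A).X)).inv ≫
    (Rel.of (words A).X ◁ Rel.coSubobject T.init) ≫ T.run ≫ Rel.ofSubobject T.final)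

variable (E) in
/-- A promonoid: a monoid object in the category of relations. -/
abbrev Promonoid := Mon (Rel E)

/-- The free promonoid on `A`: the free monoid on `A`, its structure morphisms being seen as
relations. -/
noncomputable def wordsPromonoid (A : E) : Promonoid E := Rel.graph.mapMon.obj (words A)

/-- The promonoid `M` recognises the language `L` if there are a homomorphism `h` of promonoids from
`A*` to `M` and a subobject `F` of `M` such that `L` is `A* → M → 1`, the composite of `h` and `F`.
-/
def Promonoid.Recognises {A : E} (M : Promonoid E) (L : Lang A) : Prop :=
  ∃ (h : wordsPromonoid A ⟶ M) (F : Subobject M.X.obj),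
    L = Rel.toSubobject (h.hom ≫ Rel.ofSubobject F)

end Automata

end Promonoids

open Promonoids

/-! Everything is computed with generalised elements: a relation is determined by the pairs `(a, b)`
that belong to it, and an existential statement, such as membership in a composite, is witnessed
after passing to a regular epimorphism. Membership descends along such covers, so the arguments
about sets can be repeated verbatim, with witnesses on different covers moved to a common
refinement.

From automata to promonoids, the object `S × S` carries the promonoid in which `(a, b)` and `(b, c)`
have the single product `(a, c)` and the units form the diagonal. A relation from `A*` to `S × S` is
an `A*`-indexed family of relations on `S`, and it is a homomorphism of promonoids exactly when the
family sends the empty word to the identity and concatenation to composition, that is, when its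
transpose is a homomorphism to `Ω^(S × S)`. The extended transition relation is such a family, and
the pairs of an initial and a final state cut out the language. This is where closure under products
is needed.

From promonoids to automata, a homomorphism `h` to `M` lets words act on `M` by right
multiplication. Associativity and the right unit law make the action multiplicative, so freeness of
`A*` identifies it with the extended transition relation of its restriction to letters. Starting
from the elements of the unit, a word `x` reaches exactly the elements of `h x`, by the left unit
law. The state object is `M` itself.

The two elementwise criteria `isMonHom_transpose_symm_iff` and `isMonHom_wordsPromonoid_iff` carry
both directions. -/

namespace Promonoids

open MonObj

variable {E : Type w} [Category.{u} E] [CartesianMonoidalCategory E]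

/-! ### Relations and promonoids in terms of generalised elements -/

namespace Rel

section Regular

variable [Regular E]

theorem mem_comp {A B C : Rel E} (R : A ⟶ B) (S : B ⟶ C) {X : E} (a : X ⟶ A.obj)
    (c : X ⟶ C.obj) : Hom.Mem (R ≫ S) a c ↔ ∃ (Y : E) (e : Y ⟶ X) (b : Y ⟶ B.obj),
      IsRegularEpi e ∧ Hom.Mem R (e ≫ a) b ∧ Hom.Mem S b (e ≫ c) :=
  Hom.mem_comp R S a c

theorem mem_graph_map_comp {A B : E} {C : Rel E} (f : A ⟶ B) (S : of B ⟶ C) {X : E}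
    (a : X ⟶ A) (c : X ⟶ C.obj) : Hom.Mem (graph.map f ≫ S) a c ↔ Hom.Mem S (a ≫ f) c :=
  mem_graphHom_comp f S a c

/-- The composite with `S` is treated as a whole because the monoid laws and the multiplicativity of
homomorphisms have this shape. The explicit `A := of _` exhibits the tensor product of `Rel E` as a
product in `E`, so that `lift` applies. -/
theorem mem_tensorHom_comp {A B A' B' C : Rel E} (R : A ⟶ B) (R' : A' ⟶ B') (S : B ⊗ B' ⟶ C)
    {X : E} (a : X ⟶ A.obj) (a' : X ⟶ A'.obj) (c : X ⟶ C.obj) :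
    Hom.Mem (A := of (A.obj ⊗ A'.obj)) ((R ⊗ₘ R') ≫ S) (lift a a') c ↔
      ∃ (Y : E) (e : Y ⟶ X) (b : Y ⟶ B.obj) (b' : Y ⟶ B'.obj), IsRegularEpi e ∧
        Hom.Mem R (e ≫ a) b ∧ Hom.Mem R' (e ≫ a') b' ∧
          Hom.Mem (A := of (B.obj ⊗ B'.obj)) S (lift b b') (e ≫ c) := by
  refine (Hom.mem_comp _ _ _ _).trans ⟨?_, ?_⟩
  · rintro ⟨Y, e, b, he, h1, h2⟩
    obtain ⟨h1, h1'⟩ := (Hom.mem_prod R R' _ _).1 h1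
    simp only [comp_lift, lift_fst, lift_snd] at h1 h1'
    refine ⟨Y, e, b ≫ fst B.obj B'.obj, b ≫ snd B.obj B'.obj, he, h1, h1', ?_⟩
    rw [lift_comp_fst_snd]
    exact h2
  · rintro ⟨Y, e, b, b', he, h1, h1', h2⟩
    refine ⟨Y, e, (lift b b' : Y ⟶ B.obj ⊗ B'.obj), he,
      (Hom.mem_prod R R' (e ≫ lift a a') (lift b b')).2 ?_, h2⟩
    simpa using ⟨h1, h1'⟩

theorem mem_whiskerRight_comp {A B D C : Rel E} (R : A ⟶ B) (S : B ⊗ D ⟶ C)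
    {X : E} (a : X ⟶ A.obj) (d : X ⟶ D.obj) (c : X ⟶ C.obj) :
    Hom.Mem (A := of (A.obj ⊗ D.obj)) ((R ▷ D) ≫ S) (lift a d) c ↔
      ∃ (Y : E) (e : Y ⟶ X) (b : Y ⟶ B.obj), IsRegularEpi e ∧ Hom.Mem R (e ≫ a) b ∧
        Hom.Mem (A := of (B.obj ⊗ D.obj)) S (lift b (e ≫ d)) (e ≫ c) := by
  rw [← tensorHom_id]
  refine (mem_tensorHom_comp _ _ _ _ _ _).trans ⟨?_, ?_⟩
  · rintro ⟨Y, e, b, d', he, h1, h2, h3⟩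
    obtain rfl : e ≫ d = d' := by simpa using (mem_graphHom _ _ _).1 h2
    exact ⟨Y, e, b, he, h1, h3⟩
  · rintro ⟨Y, e, b, he, h1, h2⟩
    exact ⟨Y, e, b, e ≫ d, he, h1, (mem_graphHom _ _ _).2 (by simp), h2⟩

theorem mem_whiskerLeft_comp {A B D C : Rel E} (R : A ⟶ B) (S : D ⊗ B ⟶ C)
    {X : E} (d : X ⟶ D.obj) (a : X ⟶ A.obj) (c : X ⟶ C.obj) :
    Hom.Mem (A := of (D.obj ⊗ A.obj)) ((D ◁ R) ≫ S) (lift d a) c ↔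
      ∃ (Y : E) (e : Y ⟶ X) (b : Y ⟶ B.obj), IsRegularEpi e ∧ Hom.Mem R (e ≫ a) b ∧
        Hom.Mem (A := of (D.obj ⊗ B.obj)) S (lift (e ≫ d) b) (e ≫ c) := by
  rw [← id_tensorHom]
  refine (mem_tensorHom_comp _ _ _ _ _ _).trans ⟨?_, ?_⟩
  · rintro ⟨Y, e, d', b, he, h2, h1, h3⟩
    obtain rfl : e ≫ d = d' := by simpa using (mem_graphHom _ _ _).1 h2
    exact ⟨Y, e, b, he, h1, h3⟩
  · rintro ⟨Y, e, b, he, h1, h2⟩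
    exact ⟨Y, e, e ≫ d, b, he, (mem_graphHom _ _ _).2 (by simp), h1, h2⟩

theorem mem_ofSubobject {A X : E} (P : Subobject A) (a : X ⟶ A) (b : X ⟶ 𝟙_ E) :
    Hom.Mem (A := of A) (B := of (𝟙_ E)) (ofSubobject P) a b ↔ P.Factors a := by
  refine (factors_pullback_iff _ _ _).trans ?_
  simp

theorem mem_coSubobject {A X : E} (P : Subobject A) (a : X ⟶ A) (b : X ⟶ 𝟙_ E) :
    Hom.Mem (A := of (𝟙_ E)) (B := of A) (coSubobject P) b a ↔ P.Factors a := by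
  refine (factors_pullback_iff _ _ _).trans ?_
  simp

theorem factors_toSubobject {A X : E} (R : of A ⟶ 𝟙_ (Rel E)) (a : X ⟶ A) :
    (toSubobject R).Factors a ↔ Hom.Mem (A := of A) (B := of (𝟙_ E)) R a (toUnit X) := by
  refine (factors_pullback_iff _ _ _).trans ?_
  rw [Hom.Mem]
  convert Iff.rfl using 2
  exact CartesianMonoidalCategory.hom_ext _ _ (by simp) (toUnit_unique _ _)

theorem hom_ext_mem_lift {A B C : Rel E} {R S : A ⊗ B ⟶ C}
    (h : ∀ (X : E) (a : X ⟶ A.obj) (b : X ⟶ B.obj) (c : X ⟶ C.obj),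
      Hom.Mem (A := of (A.obj ⊗ B.obj)) R (lift a b) c ↔
        Hom.Mem (A := of (A.obj ⊗ B.obj)) S (lift a b) c) : R = S := by
  refine Hom.ext_mem fun X z c => ?_
  obtain ⟨a, b, rfl⟩ : ∃ (a : X ⟶ A.obj) (b : X ⟶ B.obj), z = lift a b :=
    ⟨z ≫ fst A.obj B.obj, z ≫ snd A.obj B.obj,
      CartesianMonoidalCategory.hom_ext _ _ (by simp) (by simp)⟩
  exact h X a b c

/-- The generalised element `x` belongs to the unit of the promonoid `N`. -/
def IsOne (N : Rel E) [MonObj N] {X : E} (x : X ⟶ N.obj) : Prop :=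
  Hom.Mem (A := of (𝟙_ E)) η[N] (toUnit X) x

/-- The generalised element `z` is one of the products of `x` and `y` in the promonoid `N`. -/
def IsMul (N : Rel E) [MonObj N] {X : E} (x y z : X ⟶ N.obj) : Prop :=
  Hom.Mem (A := of (N.obj ⊗ N.obj)) μ[N] (lift x y) z

section

variable {N : Rel E} [MonObj N] {X : E}

theorem IsOne.comp {Y : E} {x : X ⟶ N.obj} (h : IsOne N x) (e : Y ⟶ X) : IsOne N (e ≫ x) := by
  unfold IsOne at h ⊢
  rw [← toUnit_unique (e ≫ toUnit X) (toUnit Y)]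
  exact Hom.Mem.comp h e

theorem IsMul.comp {Y : E} {x y z : X ⟶ N.obj} (h : IsMul N x y z) (e : Y ⟶ X) :
    IsMul N (e ≫ x) (e ≫ y) (e ≫ z) := by
  unfold IsMul at h ⊢
  rw [← comp_lift]
  exact Hom.Mem.comp h e

/-- The left unit law equates a composite relation with an identity, so it has two uses: a product
by a unit element can only be `x` itself, and every `x` has, on some cover, a unit element `b` with
`x` among the products of `b` and `x`. -/
theorem isOne_mul_iff (x z : X ⟶ N.obj) :
    (∃ (Y : E) (e : Y ⟶ X) (b : Y ⟶ N.obj), IsRegularEpi e ∧ IsOne N b ∧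
      IsMul N b (e ≫ x) (e ≫ z)) ↔ x = z := by
  have h1 := mem_whiskerRight_comp η[N] μ[N] (toUnit X) x z
  rw [MonObj.one_mul] at h1
  have h2 := (mem_graphHom (λ_ N.obj).hom (lift (toUnit X) x) z)
  rw [lift_leftUnitor_hom] at h2
  rw [← h2]
  refine Iff.trans ?_ h1.symm
  simp only [comp_toUnit, IsOne, IsMul]

theorem isMul_one_iff (x z : X ⟶ N.obj) :
    (∃ (Y : E) (e : Y ⟶ X) (b : Y ⟶ N.obj), IsRegularEpi e ∧ IsOne N b ∧
      IsMul N (e ≫ x) b (e ≫ z)) ↔ x = z := by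
  have h1 := mem_whiskerLeft_comp η[N] μ[N] x (toUnit X) z
  rw [MonObj.mul_one] at h1
  have h2 := (mem_graphHom (ρ_ N.obj).hom (lift x (toUnit X)) z)
  rw [lift_rightUnitor_hom] at h2
  rw [← h2]
  refine Iff.trans ?_ h1.symm
  simp only [comp_toUnit, IsOne, IsMul]

/-- Products are multivalued, so associativity says that `t` is reached through some value of `x y`
if and only if it is reached through some value of `y z`; the intermediate values live on covers. -/
theorem isMul_assoc_iff (x y z t : X ⟶ N.obj) :
    (∃ (Y : E) (e : Y ⟶ X) (b : Y ⟶ N.obj), IsRegularEpi e ∧ IsMul N (e ≫ x) (e ≫ y) b ∧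
      IsMul N b (e ≫ z) (e ≫ t)) ↔
    ∃ (Y : E) (e : Y ⟶ X) (b : Y ⟶ N.obj), IsRegularEpi e ∧ IsMul N (e ≫ y) (e ≫ z) b ∧
      IsMul N (e ≫ x) b (e ≫ t) := by
  have h1 := mem_whiskerRight_comp μ[N] μ[N] (lift x y : X ⟶ N.obj ⊗ N.obj) z t
  have h2 := mem_whiskerLeft_comp μ[N] μ[N] x (lift y z : X ⟶ N.obj ⊗ N.obj) t
  have h3 := mem_graphHom_comp (α_ N.obj N.obj N.obj).hom (N ◁ μ[N] ≫ μ[N])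
    (lift (lift x y) z) t
  rw [lift_lift_associator_hom] at h3
  simp only [comp_lift] at h1 h2
  refine h1.symm.trans (Iff.trans ?_ h2)
  rw [MonObj.mul_assoc]
  exact h3

end

end Regular

end Rel

/-! ### Transposition and homomorphisms -/

section Topos

variable [IsGrothendieckTopos E]

theorem transpose_comp {X X' S : E} (f : X' ⟶ X) (g : X ⟶ relObj S) :
    transpose X' S (f ≫ g) = Family.reindex S f (transpose X S g) :=
  (relObjRepr S).homEquiv_comp f g

theorem transpose_one (S : E) : transpose (𝟙_ E) S η[relObj S] = 1 :=
  (relObjRepr S).homEquiv.apply_symm_apply _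

/-- The multiplication of `relObj S` comes from the Yoneda lemma: it represents the product of the
two projections, taken in the monoid of families. -/
theorem transpose_mul (S : E) : transpose (relObj S ⊗ relObj S) S μ[relObj S] =
    transpose _ S (fst (relObj S) (relObj S)) * transpose _ S (snd (relObj S) (relObj S)) :=
  (relObjRepr S).homEquiv.apply_symm_apply _

theorem mem_transpose_comp {X X' S Y : E} (f : X' ⟶ X) (g : X ⟶ relObj S) (x : Y ⟶ X')
    (s t : Y ⟶ S) : Rel.Hom.Mem (transpose X' S (f ≫ g)) (lift x s) t ↔
      Rel.Hom.Mem (transpose X S g) (lift (x ≫ f) s) t := by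
  rw [transpose_comp]
  refine (Family.mem_reindex _ _ _ _).trans ?_
  rw [lift_whiskerRight]

theorem mem_transpose_lift_mul {X S Y : E} (f g : X ⟶ relObj S) (x : Y ⟶ X) (s t : Y ⟶ S) :
    Rel.Hom.Mem (transpose X S (lift f g ≫ μ[relObj S])) (lift x s) t ↔
      ∃ (Z : E) (e : Z ⟶ Y) (r : Z ⟶ S), IsRegularEpi e ∧
        Rel.Hom.Mem (transpose X S f) (lift (e ≫ x) (e ≫ s)) r ∧
        Rel.Hom.Mem (transpose X S g) (lift (e ≫ x) r) (e ≫ t) := by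
  rw [mem_transpose_comp, transpose_mul]
  refine (Family.mem_mul _ _ _ _).trans ?_
  have h1 {Z : E} (z : Z ⟶ X) (s t : Z ⟶ S) := mem_transpose_comp (lift f g) (fst _ _) z s t
  have h2 {Z : E} (z : Z ⟶ X) (s t : Z ⟶ S) := mem_transpose_comp (lift f g) (snd _ _) z s t
  simp only [lift_fst, lift_snd] at h1 h2
  simp only [h1, h2, comp_lift, lift_fst, Category.assoc]

/-- A family of relations indexed by a monoid is classified by a homomorphism exactly when it is
the identity at the unit and turns products into composites. -/
theorem isMonHom_transpose_symm_iff {M S : E} [MonObj M] (R : Family M S) :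
    IsMonHom ((transpose M S).symm R) ↔
      (∀ {Y : E} (s t : Y ⟶ S), Rel.Hom.Mem R (lift (toUnit Y ≫ η[M]) s) t ↔ s = t) ∧
      ∀ {Y : E} (x y : Y ⟶ M) (s t : Y ⟶ S),
        Rel.Hom.Mem R (lift (lift x y ≫ μ[M]) s) t ↔
          ∃ (Z : E) (e : Z ⟶ Y) (r : Z ⟶ S), IsRegularEpi e ∧
            Rel.Hom.Mem R (lift (e ≫ x) (e ≫ s)) r ∧
            Rel.Hom.Mem R (lift (e ≫ y) r) (e ≫ t) := by
  obtain ⟨g, rfl⟩ := (transpose M S).surjective R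
  rw [Equiv.symm_apply_apply]
  have key {Y : E} (x y : Y ⟶ M) (s t : Y ⟶ S) :
      Rel.Hom.Mem (transpose (M ⊗ M) S ((g ⊗ₘ g) ≫ μ[relObj S])) (lift (lift x y) s) t ↔
        ∃ (Z : E) (e : Z ⟶ Y) (r : Z ⟶ S), IsRegularEpi e ∧
          Rel.Hom.Mem (transpose M S g) (lift (e ≫ x) (e ≫ s)) r ∧
          Rel.Hom.Mem (transpose M S g) (lift (e ≫ y) r) (e ≫ t) := by
    have : g ⊗ₘ g = lift (fst M M ≫ g) (snd M M ≫ g) := by ext <;> simp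
    rw [this, mem_transpose_lift_mul]
    simp only [mem_transpose_comp]
    simp
  have key' {Y : E} (s t : Y ⟶ S) :
      Rel.Hom.Mem (transpose (𝟙_ E) S η[relObj S]) (lift (toUnit Y) s) t ↔ s = t := by
    rw [transpose_one]
    refine (Family.mem_one _ _).trans ?_
    rw [lift_snd]
  constructor
  · intro h
    refine ⟨fun s t => ?_, fun x y s t => ?_⟩
    · rw [← mem_transpose_comp, IsMonHom.one_hom, key']
    · rw [← mem_transpose_comp, IsMonHom.mul_hom, key]
  · rintro ⟨h1, h2⟩
    -- Transposition is injective, so both homomorphism equations can be tested on elements of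
    -- families.
    refine ⟨(transpose _ S).injective (Family.ext_mem fun Y z t => ?_),
      (transpose _ S).injective (Family.ext_mem fun Y z t => ?_)⟩
    · obtain ⟨s, rfl⟩ : ∃ s, z = lift (toUnit Y) s := ⟨z ≫ snd _ _,
        CartesianMonoidalCategory.hom_ext _ _ (toUnit_unique _ _) (by simp)⟩
      rw [mem_transpose_comp, key', h1]
    · obtain ⟨x, y, s, rfl⟩ : ∃ x y s, z = lift (lift x y) s :=
        ⟨(z ≫ fst _ _) ≫ fst _ _, (z ≫ fst _ _) ≫ snd _ _, z ≫ snd _ _, by ext <;> simp⟩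
      rw [mem_transpose_comp, key, h2]

/-- The structure morphisms of the free promonoid are graphs, so composing with them only
substitutes into `h`. The shape matches `isMonHom_transpose_symm_iff`, which makes homomorphisms of
the two kinds comparable. -/
theorem isMonHom_wordsPromonoid_iff {A : E} {N : Promonoid E} (h : (Rel.of (words A).X) ⟶ N.X) :
    IsMonHom (M := (wordsPromonoid A).X) h ↔
      (∀ {Y : E} (n : Y ⟶ N.X.obj), Rel.Hom.Mem h (toUnit Y ≫ η[(words A).X]) n ↔
        Rel.IsOne N.X n) ∧
      ∀ {Y : E} (x y : Y ⟶ (words A).X) (n : Y ⟶ N.X.obj),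
        Rel.Hom.Mem h (lift x y ≫ μ[(words A).X]) n ↔
          ∃ (Z : E) (e : Z ⟶ Y) (b c : Z ⟶ N.X.obj), IsRegularEpi e ∧
            Rel.Hom.Mem h (e ≫ x) b ∧ Rel.Hom.Mem h (e ≫ y) c ∧ Rel.IsMul N.X b c (e ≫ n) := by
  -- The comparison morphisms of the monoidal functor `graph` are identities.
  have e1 : η[(wordsPromonoid A).X] = Rel.graph.map η[(words A).X] := Category.id_comp _
  have e2 : μ[(wordsPromonoid A).X] = Rel.graph.map μ[(words A).X] := Category.id_comp _
  have k1 {Y : E} (n : Y ⟶ N.X.obj) :=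
    Rel.mem_graph_map_comp η[(words A).X] h (toUnit Y) n
  have k2 {Y : E} (x y : Y ⟶ (words A).X) (n : Y ⟶ N.X.obj) :=
    Rel.mem_graph_map_comp μ[(words A).X] h (lift x y) n
  have k3 {Y : E} (x y : Y ⟶ (words A).X) (n : Y ⟶ N.X.obj) :=
    Rel.mem_tensorHom_comp h h μ[N.X] x y n
  constructor
  · intro hh
    refine ⟨fun {Y} n => ?_, fun x y n => ?_⟩
    · refine (k1 n).symm.trans ?_
      have := hh.one_hom
      rw [e1] at this
      exact iff_of_eq (congrArg (fun R => Rel.Hom.Mem (A := Rel.of (𝟙_ E)) R (toUnit Y) n) this)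
    · refine (k2 x y n).symm.trans (Iff.trans ?_ (k3 x y n))
      have := hh.mul_hom
      rw [e2] at this
      exact iff_of_eq (congrArg
        (fun R => Rel.Hom.Mem (A := Rel.of ((words A).X ⊗ (words A).X)) R (lift x y) n) this)
  · rintro ⟨h1, h2⟩
    constructor
    · rw [e1]
      refine Rel.Hom.ext_mem fun Y z n => ?_
      obtain rfl : toUnit Y = z := toUnit_unique _ _
      exact (k1 n).trans (h1 n)
    · rw [e2]
      refine Rel.hom_ext_mem_lift fun Y x y n => ?_
      exact (k2 x y n).trans ((h2 x y n).trans (k3 x y n).symm)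

/-- The inclusion of the letters into the words. -/
noncomputable def letters (A : E) : A ⟶ (words A).X :=
  (Adjunction.ofIsRightAdjoint (Mon.forget E)).unit.app A

/-- The uniqueness half of freeness. -/
theorem wordsExtend_eq {A : E} {M : Mon E} (g : words A ⟶ M) :
    wordsExtend (letters A ≫ g.hom) = g :=
  (congrArg _ ((Adjunction.ofIsRightAdjoint (Mon.forget E)).homEquiv_unit _ _ g).symm).trans
    (((Adjunction.ofIsRightAdjoint (Mon.forget E)).homEquiv A M).symm_apply_apply g)

/-! ### Runs and languages of automata -/

namespace Automaton

variable {A : E} (T : Automaton A)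

theorem isMonHom_transpose_symm_run :
    IsMonHom ((transpose (words A).X T.state).symm T.run) := by
  rw [Automaton.run, Equiv.symm_apply_apply]
  exact (wordsExtend (M := Mon.mk (relObj T.state)) _).isMonHom_hom

/-- The extended transition relation is the only family of relations that is multiplicative and
restricts to the transition relation. -/
theorem run_eq (R : Family (words A).X T.state)
    [h : IsMonHom ((transpose (words A).X T.state).symm R)]
    (hR : Family.reindex T.state (letters A) R =
      T.trans) : T.run = R := by
  rw [Automaton.run]
  have := wordsExtend_eq (A := A) (M := Mon.mk (relObj T.state))
    ⟨(transpose (words A).X T.state).symm R⟩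
  -- On letters, the transpose of `R` agrees with the transpose of the transition relation, so
  -- freeness applies.
  have h2 : (transpose _ _).symm T.trans =
      letters A ≫ (transpose (words A).X T.state).symm R := by
    refine (Equiv.symm_apply_eq _).2 (Eq.trans ?_ (transpose_comp _ _).symm)
    rw [Equiv.apply_symm_apply]
    exact hR.symm
  rw [h2]
  refine (congrArg (fun k => transpose _ _ (Mon.Hom.hom k)) this).trans ?_
  exact Equiv.apply_symm_apply _ _

theorem factors_language {X : E} (x : X ⟶ (words A).X) :
    T.language.Factors x ↔ ∃ (Y : E) (e : Y ⟶ X) (s t : Y ⟶ T.state), IsRegularEpi e ∧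
      T.init.Factors s ∧ T.final.Factors t ∧
        Rel.Hom.Mem (A := .of ((words A).X ⊗ T.state)) T.run (lift (e ≫ x) s) t := by
  rw [Automaton.language, Rel.factors_toSubobject]
  refine (Rel.mem_graph_map_comp (ρ_ (words A).X).inv _ _ _).trans ?_
  have : x ≫ (ρ_ (words A).X).inv = lift x (toUnit _) :=
    CartesianMonoidalCategory.hom_ext _ _ (by simp) (toUnit_unique _ _)
  rw [this]
  refine (Rel.mem_whiskerLeft_comp _ _ _ _ _).trans ?_
  constructor
  · rintro ⟨Y, e, s, he, h1, h2⟩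
    obtain ⟨Z, e', t, he', h2, h3⟩ := (Rel.mem_comp _ _ _ _).1 h2
    have h1 := (Rel.mem_coSubobject _ _ _).1 h1
    refine ⟨Z, e' ≫ e, e' ≫ s, t, cover_comp _ _, Subobject.factors_of_factors_right _ h1,
      (Rel.mem_ofSubobject _ _ _).1 h3, ?_⟩
    convert h2 using 1
    exact CartesianMonoidalCategory.hom_ext _ _ (by simp) (by simp)
  · rintro ⟨Y, e, s, t, he, h1, h2, h3⟩
    refine ⟨Y, e, s, he, (Rel.mem_coSubobject _ _ _).2 h1, (Rel.mem_comp _ _ _ _).2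
      ⟨Y, 𝟙 _, t, inferInstance, ?_, (Rel.mem_ofSubobject _ _ _).2 h2⟩⟩
    rw [Category.id_comp]
    exact h3

end Automaton

end Topos

/-! ### The promonoid of pairs -/

namespace Rel

section Pairs

variable [Regular E]

/-- The diagonal of `S`, as a relation from the terminal object to `S × S`. -/
noncomputable def pairsOne (S : E) : Hom (of (𝟙_ E)) (of (S ⊗ S)) :=
  ⟨equalizerSubobject (snd (𝟙_ E) (S ⊗ S) ≫ fst S S) (snd (𝟙_ E) (S ⊗ S) ≫ snd S S)⟩

/-- The composition of pairs: the relation of all `(((a, b), (b, c)), (a, c))`. -/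
noncomputable def pairsMul (S : E) : Hom (of ((S ⊗ S) ⊗ (S ⊗ S))) (of (S ⊗ S)) :=
  ⟨equalizerSubobject (fst ((S ⊗ S) ⊗ (S ⊗ S)) (S ⊗ S) ≫ fst _ _ ≫ snd S S)
      (fst ((S ⊗ S) ⊗ (S ⊗ S)) (S ⊗ S) ≫ snd _ _ ≫ fst S S) ⊓
    (equalizerSubobject (fst ((S ⊗ S) ⊗ (S ⊗ S)) (S ⊗ S) ≫ fst _ _ ≫ fst S S)
      (snd ((S ⊗ S) ⊗ (S ⊗ S)) (S ⊗ S) ≫ fst S S) ⊓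
    equalizerSubobject (fst ((S ⊗ S) ⊗ (S ⊗ S)) (S ⊗ S) ≫ snd _ _ ≫ snd S S)
      (snd ((S ⊗ S) ⊗ (S ⊗ S)) (S ⊗ S) ≫ snd S S))⟩

theorem mem_pairsOne {S X : E} (u : X ⟶ 𝟙_ E) (p : X ⟶ S ⊗ S) :
    (pairsOne S).Mem u p ↔ p ≫ fst S S = p ≫ snd S S := by
  refine (equalizerSubobject_factors_iff _ _ _).trans ?_
  simp

theorem mem_pairsMul {S X : E} (p q r : X ⟶ S ⊗ S) :
    (pairsMul S).Mem (lift p q) r ↔ p ≫ snd S S = q ≫ fst S S ∧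
      p ≫ fst S S = r ≫ fst S S ∧ q ≫ snd S S = r ≫ snd S S := by
  refine (Subobject.inf_factors _).trans (Iff.and (equalizerSubobject_factors_iff _ _ _)
    ((Subobject.inf_factors _).trans (Iff.and (equalizerSubobject_factors_iff _ _ _)
      (equalizerSubobject_factors_iff _ _ _)))) |>.trans ?_
  simp

/-- The promonoid of pairs: the product of `(a, b)` and `(b, c)` is `(a, c)`. -/
noncomputable abbrev pairs (S : E) : MonObj (of (S ⊗ S)) where
  one := pairsOne S
  mul := pairsMul S
  one_mul := by
    refine hom_ext_mem_lift fun X u q r => (mem_whiskerRight_comp _ _ _ _ _).trans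
      (Iff.trans ?_ (mem_graphHom _ _ _).symm)
    refine Iff.trans (b := q = r) ?_ (Eq.congr_left (lift_leftUnitor_hom u q)).symm
    constructor
    · rintro ⟨Y, e, b, he, h1, h2⟩
      have : Epi e := (IsRegularEpi.getStruct e).epi
      have h1 := (mem_pairsOne _ _).1 h1
      obtain ⟨h2, h3, h4⟩ := (mem_pairsMul _ _ _).1 h2
      -- Covers are epimorphisms, so equalities found on a cover descend.
      rw [← cancel_epi e]
      exact CartesianMonoidalCategory.hom_ext _ _ (by rw [← h2, ← h1, h3]) h4
    · rintro rfl
      -- The left unit of `(a, b)` is `(a, a)`; its right unit, used below, is `(b, b)`.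
      refine ⟨X, 𝟙 X, lift (q ≫ fst S S) (q ≫ fst S S), inferInstance,
        (mem_pairsOne _ _).2 (by simp), (mem_pairsMul _ _ _).2 (by simp)⟩
  mul_one := by
    refine hom_ext_mem_lift fun X q u r => (mem_whiskerLeft_comp _ _ _ _ _).trans
      (Iff.trans ?_ (mem_graphHom _ _ _).symm)
    refine Iff.trans (b := q = r) ?_ (Eq.congr_left (lift_rightUnitor_hom q u)).symm
    constructor
    · rintro ⟨Y, e, b, he, h1, h2⟩
      have : Epi e := (IsRegularEpi.getStruct e).epi
      have h1 := (mem_pairsOne _ _).1 h1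
      obtain ⟨h2, h3, h4⟩ := (mem_pairsMul _ _ _).1 h2
      rw [← cancel_epi e]
      exact CartesianMonoidalCategory.hom_ext _ _ h3 (by rw [h2, h1, h4])
    · rintro rfl
      refine ⟨X, 𝟙 X, lift (q ≫ snd S S) (q ≫ snd S S), inferInstance,
        (mem_pairsOne _ _).2 (by simp), (mem_pairsMul _ _ _).2 (by simp)⟩
  mul_assoc := by
    refine hom_ext_mem_lift fun X z r t => ?_
    obtain ⟨p, q, rfl⟩ : ∃ p q : X ⟶ S ⊗ S, z = lift p q :=
      ⟨z ≫ fst (S ⊗ S) (S ⊗ S), z ≫ snd (S ⊗ S) (S ⊗ S), (lift_comp_fst_snd _).symm⟩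
    refine (mem_whiskerRight_comp _ _ _ _ _).trans
      (Iff.trans ?_ (mem_graphHom_comp _ _ _ _).symm)
    rw [lift_lift_associator_hom]
    refine Iff.trans ?_ (mem_whiskerLeft_comp _ _ _ _ _).symm
    simp only [comp_lift]
    constructor
    · rintro ⟨Y, e, b, he, h1, h2⟩
      obtain ⟨h1, h3, h4⟩ := (mem_pairsMul _ _ _).1 h1
      obtain ⟨h5, h6, h7⟩ := (mem_pairsMul _ _ _).1 h2
      -- The intermediate product is forced: the outer coordinates of `q` and `r` here, those of `p`
      -- and `q` in the converse.
      refine ⟨Y, e, lift ((e ≫ q) ≫ fst S S) ((e ≫ r) ≫ snd S S), he,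
        (mem_pairsMul _ _ _).2 ⟨h4.trans h5, (lift_fst _ _).symm, (lift_snd _ _).symm⟩,
        (mem_pairsMul _ _ _).2 ⟨?_, h3.trans h6, ?_⟩⟩
      · rw [lift_fst, h1]
      · rw [lift_snd, h7]
    · rintro ⟨Y, e, b, he, h1, h2⟩
      obtain ⟨h1, h3, h4⟩ := (mem_pairsMul _ _ _).1 h1
      obtain ⟨h5, h6, h7⟩ := (mem_pairsMul _ _ _).1 h2
      refine ⟨Y, e, lift ((e ≫ p) ≫ fst S S) ((e ≫ q) ≫ snd S S), he,
        (mem_pairsMul _ _ _).2 ⟨h5.trans h3.symm, (lift_fst _ _).symm, (lift_snd _ _).symm⟩,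
        (mem_pairsMul _ _ _).2 ⟨?_, ?_, h4.trans h7⟩⟩
      · rw [lift_snd, h1]
      · rw [lift_fst, h6]

end Pairs

end Rel

variable [IsGrothendieckTopos E] {A : E}

/-! ### From automata to promonoids -/

namespace Automaton

variable (T : Automaton A)

/-- The promonoid of pairs of states of an automaton. -/
noncomputable def promonoid : Promonoid E :=
  letI := Rel.pairs T.state
  Mon.mk (Rel.of (T.state ⊗ T.state))

/-- The relation between words `x` and pairs `(s, t)` of states such that `x` leads from `s` to
`t`. -/
noncomputable def runPairs : Rel.Hom (Rel.of (words A).X) (Rel.of (T.state ⊗ T.state)) :=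
  ⟨(Subobject.pullback (α_ (words A).X T.state T.state).inv).obj (Rel.Hom.rel T.run)⟩

theorem mem_runPairs {X : E} (x : X ⟶ (words A).X) (p : X ⟶ T.state ⊗ T.state) :
    T.runPairs.Mem x p ↔ Rel.Hom.Mem (A := .of ((words A).X ⊗ T.state)) T.run
      (lift x (p ≫ fst _ _)) (p ≫ snd _ _) := by
  refine (factors_pullback_iff _ _ _).trans ?_
  obtain ⟨s, t, rfl⟩ : ∃ s t, p = lift s t := ⟨_, _, (lift_comp_fst_snd p).symm⟩
  rw [lift_lift_associator_inv, lift_fst, lift_snd]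
  rfl

/-- The two homomorphism criteria become the same condition: the identity relation is membership in
the diagonal, and composing through a middle state `r` is factoring `(s, t)` as the product of `(s,
r)` and `(r, t)`. -/
theorem isMonHom_runPairs :
    IsMonHom (M := (wordsPromonoid A).X) (N := T.promonoid.X) T.runPairs := by
  obtain ⟨h1, h2⟩ := (isMonHom_transpose_symm_iff _).1 T.isMonHom_transpose_symm_run
  refine (isMonHom_wordsPromonoid_iff (N := T.promonoid) T.runPairs).2
    ⟨fun n => ?_, fun x y (n : _ ⟶ T.state ⊗ T.state) => ?_⟩
  · exact (T.mem_runPairs _ _).trans ((h1 _ _).trans (Rel.mem_pairsOne _ _).symm)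
  · refine (T.mem_runPairs _ _).trans ((h2 _ _ _ _).trans ⟨?_, ?_⟩)
    · rintro ⟨Z, e, r, he, h3, h4⟩
      refine ⟨Z, e, lift (e ≫ n ≫ fst T.state T.state) r, lift r (e ≫ n ≫ snd T.state T.state), he,
        (T.mem_runPairs _ _).2 ?_, (T.mem_runPairs _ _).2 ?_, (Rel.mem_pairsMul _ _ _).2 ?_⟩
      · rw [lift_fst, lift_snd]
        exact h3
      · rw [lift_fst, lift_snd]
        exact h4
      · simp only [lift_fst, lift_snd, true_and]
        exact ⟨(Category.assoc _ _ _).symm, (Category.assoc _ _ _).symm⟩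
    · rintro ⟨Z, e, (b : _ ⟶ T.state ⊗ T.state), (c : _ ⟶ T.state ⊗ T.state), he, h3, h4, h5⟩
      have h3 := (T.mem_runPairs _ _).1 h3
      have h4 := (T.mem_runPairs _ _).1 h4
      obtain ⟨h5, h6, h7⟩ := (Rel.mem_pairsMul _ _ _).1 h5
      replace h6 := h6.trans (Category.assoc _ _ _)
      replace h7 := h7.trans (Category.assoc _ _ _)
      refine ⟨Z, e, b ≫ snd T.state T.state, he, ?_, ?_⟩
      · rw [h6] at h3
        exact h3
      · rw [← h5, h7] at h4
        exact h4

theorem promonoid_recognises : T.promonoid.Recognises T.language := by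
  refine ⟨@Mon.Hom.mk _ _ _ (wordsPromonoid A) T.promonoid T.runPairs T.isMonHom_runPairs,
    -- A pair is accepting when it goes from an initial state to a final one.
    (Subobject.pullback (fst T.state T.state)).obj T.init ⊓
      (Subobject.pullback (snd T.state T.state)).obj T.final, subobject_ext fun X x => ?_⟩
  rw [T.factors_language]
  refine Iff.trans ?_ ((Rel.factors_toSubobject _ _).trans (Rel.mem_comp _ _ _ _)).symm
  constructor
  · rintro ⟨Y, e, s, t, he, h1, h2, h3⟩
    refine ⟨Y, e, (lift s t : Y ⟶ T.state ⊗ T.state), he, (T.mem_runPairs _ _).2 ?_,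
      (Rel.mem_ofSubobject _ _ _).2 ((Subobject.inf_factors _).2 ⟨?_, ?_⟩)⟩
    · rw [lift_fst, lift_snd]
      exact h3
    · exact (factors_pullback_iff _ _ _).2 ((congrArg T.init.Factors (lift_fst s t)).mpr h1)
    · exact (factors_pullback_iff _ _ _).2 ((congrArg T.final.Factors (lift_snd s t)).mpr h2)
  · rintro ⟨Y, e, p, he, h1, h2⟩
    have h2 := (Subobject.inf_factors _).1 ((Rel.mem_ofSubobject _ _ _).1 h2)
    exact ⟨Y, e, p ≫ fst T.state T.state, p ≫ snd T.state T.state, he,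
      (factors_pullback_iff _ _ _).1 h2.1, (factors_pullback_iff _ _ _).1 h2.2,
      (T.mem_runPairs _ _).1 h1⟩

end Automaton

/-! ### From promonoids to automata -/

namespace Promonoid

variable {M : Promonoid E} (h : wordsPromonoid A ⟶ M) (F : Subobject M.X.obj)

/-- The right action of the words on a promonoid `M` along a homomorphism `h`: the relation of all
`((x, s), t)` such that `t` is a product of `s` and an element of `h x`. -/
noncomputable def act : Family (words A).X M.X.obj :=
  Rel.graph.map (lift (snd (words A).X M.X.obj) (fst _ _)) ≫ (M.X ◁ h.hom) ≫ μ[M.X]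

theorem mem_act {X : E} (x : X ⟶ (words A).X) (s t : X ⟶ M.X.obj) :
    Rel.Hom.Mem (act h) (lift x s) t ↔ ∃ (Y : E) (e : Y ⟶ X) (b : Y ⟶ M.X.obj), IsRegularEpi e ∧
      Rel.Hom.Mem (A := .of (words A).X) h.hom (e ≫ x) b ∧
        Rel.IsMul M.X (e ≫ s) b (e ≫ t) := by
  refine (Rel.mem_graph_map_comp _ _ _ _).trans ?_
  rw [comp_lift, lift_fst, lift_snd]
  exact Rel.mem_whiskerLeft_comp _ _ _ _ _

/-- The right unit law gives the identity at the empty word, and associativity turns `s (x y)` into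
`(s x) y`. The action is on the right because composition in `Ω^(S × S)` reads "first `R`, then
`R'`". -/
theorem isMonHom_act :
    IsMonHom ((transpose (words A).X M.X.obj).symm (act h)) := by
  obtain ⟨h1, h2⟩ := (isMonHom_wordsPromonoid_iff (N := M) h.hom).1 h.isMonHom_hom
  refine (isMonHom_transpose_symm_iff _).2 ⟨fun s t => ?_, fun x y s t => ?_⟩
  · rw [mem_act, ← Rel.isMul_one_iff s t]
    simp only [comp_toUnit_assoc, h1]
  · simp only [mem_act]
    constructor
    · rintro ⟨Y, e, b, he, h3, h4⟩
      rw [comp_lift_assoc] at h3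
      -- On a cover, `b` in `h (x y)` is a product of some `c` in `h x` and `d` in `h y`;
      -- reassociating produces the state `r` between `x` and `y`.
      obtain ⟨Z, e', c, d, he', h5, h6, h7⟩ := (h2 _ _ _).1 h3
      obtain ⟨W, f, r, hf, h8, h9⟩ := (Rel.isMul_assoc_iff ((e' ≫ e) ≫ s) c d ((e' ≫ e) ≫ t)).2
        ⟨Z, 𝟙 Z, e' ≫ b, inferInstance, by simpa using h7, by simpa using h4.comp e'⟩
      refine ⟨W, f ≫ e' ≫ e, r, cover_comp _ _, ⟨W, 𝟙 W, f ≫ c, inferInstance, ?_, ?_⟩,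
        ⟨W, 𝟙 W, f ≫ d, inferInstance, ?_, ?_⟩⟩
      · simpa using h5.comp f
      · simpa using h8
      · simpa using h6.comp f
      · simpa using h9
    · rintro ⟨Y, e, r, he, ⟨Z, f, b, hf, h3, h4⟩, ⟨Z', f', c, hf', h5, h6⟩⟩
      -- The witnesses `b` and `c` live on different covers; the pullback is a common refinement.
      let g := pullback.fst f f'
      let g' := pullback.snd f f'
      have w : g ≫ f = g' ≫ f' := pullback.condition
      have hg : IsRegularEpi g := inferInstance
      have h4 := h4.comp g
      have h6 := h6.comp g'
      rw [← reassoc_of% w, ← reassoc_of% w] at h6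
      obtain ⟨W, k, d, hk, h7, h8⟩ := (Rel.isMul_assoc_iff (g ≫ f ≫ e ≫ s) (g ≫ b) (g' ≫ c)
        (g ≫ f ≫ e ≫ t)).1 ⟨_, 𝟙 _, g ≫ f ≫ r, inferInstance, by simpa using h4, by simpa using h6⟩
      refine ⟨W, k ≫ g ≫ f ≫ e, d, inferInstance, ?_, by simpa using h8⟩
      rw [comp_lift_assoc]
      refine (h2 _ _ _).2 ⟨W, 𝟙 W, k ≫ g ≫ b, k ≫ g' ≫ c, inferInstance, ?_, ?_, by simpa using h7⟩
      · simpa using h3.comp (k ≫ g)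
      · have := h5.comp (k ≫ g')
        simp only [Category.assoc] at this
        rw [← reassoc_of% w] at this
        simpa using this

/-- The automaton of a homomorphism `h` from the words to a promonoid `M`: its states are the
elements of `M`, those of the unit being initial, and a letter acts by right multiplication. -/
noncomputable def automaton : Automaton A where
  state := M.X.obj
  init := (Subobject.pullback (lift (toUnit M.X.obj) (𝟙 M.X.obj))).obj (Rel.Hom.rel η[M.X])
  final := F
  trans := Family.reindex M.X.obj (letters A) (act h)

theorem factors_automaton_init {X : E} (s : X ⟶ M.X.obj) :
    (automaton h F).init.Factors s ↔ Rel.IsOne M.X s := by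
  refine (factors_pullback_iff _ _ _).trans ?_
  refine Iff.of_eq (congrArg (Subobject.Factors (Rel.Hom.rel η[M.X])) ?_)
  exact CartesianMonoidalCategory.hom_ext _ _ (toUnit_unique _ _)
    ((Category.assoc _ _ _).trans
      ((congrArg (s ≫ ·) (lift_snd _ _)).trans ((Category.comp_id s).trans (lift_snd _ _).symm)))

/-- The transitions are by definition the restriction of `act h` to letters, so uniqueness of the
multiplicative extension applies and the restriction condition holds by `rfl`. -/
theorem automaton_run : (automaton h F).run = act h :=
  (automaton h F).run_eq (act h) (h := isMonHom_act h) rfl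

/-- An accepting run leads from a unit element `s` to some `t` in `F` that is a product of `s` and
an element of `h x`; the left unit law says that this element is `t`. -/
theorem automaton_language :
    (automaton h F).language = Rel.toSubobject (h.hom ≫ Rel.ofSubobject F) := by
  refine subobject_ext fun X x => ?_
  rw [Automaton.factors_language, automaton_run]
  refine Iff.trans ?_ ((Rel.factors_toSubobject _ _).trans (Rel.mem_comp _ _ _ _)).symm
  constructor
  · rintro ⟨Y, e, s, t, he, h1, h2, h3⟩
    obtain ⟨Z, f, b, hf, h4, h5⟩ := (mem_act h _ _ _).1 h3
    have h1 := ((factors_automaton_init h F s).1 h1).comp f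
    obtain rfl := (Rel.isOne_mul_iff b (f ≫ t)).1
      ⟨Z, 𝟙 Z, f ≫ s, inferInstance, h1, by simpa using h5⟩
    refine ⟨Z, f ≫ e, f ≫ t, cover_comp _ _, by simpa using h4, (Rel.mem_ofSubobject _ _ _).2 ?_⟩
    exact Subobject.factors_of_factors_right _ h2
  · rintro ⟨Y, e, t, he, h1, h2⟩
    -- The initial state depends on `t`: the unit of a promonoid is a subobject, and only some of
    -- its elements need act as a left unit on `t`.
    obtain ⟨Z, f, s, hf, h3, h4⟩ := (Rel.isOne_mul_iff t t).2 rfl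
    refine ⟨Z, f ≫ e, s, f ≫ t, cover_comp _ _, (factors_automaton_init h F s).2 h3,
      Subobject.factors_of_factors_right _ ((Rel.mem_ofSubobject _ _ _).1 h2), ?_⟩
    refine (mem_act h ((f ≫ e) ≫ x) s (f ≫ t)).2 ⟨Z, 𝟙 Z, f ≫ t, inferInstance, ?_, ?_⟩
    · simpa using Rel.Hom.Mem.comp h1 f
    · simpa only [Category.id_comp] using h4.comp (𝟙 Z)

end Promonoid

end Promonoids

theorem theoremt {E : Type w} [Category.{u} E] [CartesianMonoidalCategory E]
    [IsGrothendieckTopos E] (K : ObjectProperty E)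
    (hK : ∀ X Y : E, K X → K Y → K (X ⊗ Y)) (A : E) (L : Lang A) :
    (∃ T : Automaton A, K T.state ∧ T.language = L) ↔
      ∃ M : Promonoid E, K M.X.obj ∧ M.Recognises L := by
  constructor
  · rintro ⟨T, hT, rfl⟩
    exact ⟨T.promonoid, hK _ _ hT hT, T.promonoid_recognises⟩
  · rintro ⟨M, hM, h, F, rfl⟩
    exact ⟨Promonoid.automaton h F, hM, Promonoid.automaton_language h F⟩
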